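/- **Theorem (Existence of a variational Wardrop equilibrium).** Let $T\ge 1$ be an integer, $\Theta=[0,1]$ with Lebesgue measure, $M>0$, and $\mathcal M=[0,M+1]^T\subset\mathbb R^T$. Consider a nonatomic aggregative game given by action sets $\mathcal X_\theta\subset\mathbb R^T$ and cost functions $f_\theta(x,Y)$ ($\theta\in\Theta$; $x$ is the player's own action and $Y$ the aggregate action). Assume the following. 1. For every $\theta$ the set $\mathcal X_\theta$ is nonempty, convex, compact, contained in $\{x:\|x\|\le M\}$ and contained in $\mathcal M$; the graph $\{(\theta,x):\theta\in\Theta,\ x\in\mathcal X_\theta\}$ is a Borel set. 2. There is a neighborhood $\mathcal M'$ of $\mathcal M$, convex and independent of $\theta$, such that every $f_\theta$ is a real function on $\mathcal M'\times\mathcal M'$, bounded on $\mathcal M\times\mathcal M$, and for every $Y\in\mathcal M$: (i) for every $x\in\mathcal M$ the function $\theta\mapsto f_\theta(x,Y)$ is Lebesgue measurable on $\Theta$; (ii) for every $\theta$ the function $f_\theta(\cdot,Y)$ is continuous and convex on $\mathcal M'$. Write $\partial_1f_\theta(x,Y)=\{g\in\mathbb R^T: f_\theta(z,Y)\ge f_\theta(x,Y)+\langle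 g,z-x\rangle\ \forall z\in\mathcal M'\}$. (iii) There is a constant $B>0$ such that $\|g\|\le B$ for all $\theta\in\Theta$, $x,Y\in\mathcal M$ and $g\in\partial_1f_\theta(x,Y)$. 3. For every $\theta\in\Theta$ and $x\in\mathcal M$ the function $f_\theta(x,\cdot)$ is continuous on $\mathcal M$. Let $\mathcal X=\{x\in L^2([0,1],\mathbb R^T): x_\theta\in\mathcal X_\theta\text{ for a.e. }\theta\}$. Let $A\subset\mathbb R^T$ be convex and compact and such that $\mathcal X(A)=\{x\in\mathcal X:\int_0^1x_\theta\,d\theta\in A\}$ is nonempty (equivalently, $A$ meets the set $\{\int_0^1 x_\theta\,d\theta : x\in\mathcal X\}$ of feasible aggregate actions). For a profile $x$ put $$H(x)=\Big\{g\in L^2([0,1],\mathbb R^T): g_\theta\in\partial_1f_\theta\big(x_\theta,\textstyle\int_0^1x_\xi\,d\xi\big)\text{ for a.e. }\theta\in\Theta\Big\}.$$ Suppose that the game is monotone on $\mathcal X(A)$, that is, $\int_0^1\langle g_\theta-h_\theta,x_\theta-y_\theta\rangle\,d\theta\ge0$ for all $x,y\in\mathcal X(A)$, $g\in H(x)$,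 $h\in H(y)$. Then a variational Wardrop equilibrium exists: there are $x^*\in\mathcal X(A)$ and $g\in H(x^*)$ such that $$\int_0^1\langle g_\theta,x_\theta-x^*_\theta\rangle\,d\theta\ge0\qquad\text{for all }x\in\mathcal X(A).$$ -/

import Mathlib

open MeasureTheory Set Topology

noncomputable section

/-- The Euclidean space `ℝ^T`. -/
abbrev Act (T : ℕ) : Type := EuclideanSpace ℝ (Fin T)

/-- The Hilbert space `L²([0,1], ℝ^T)`; the interval `[0,1]` carries Lebesgue measure. -/
abbrev Profile (T : ℕ) : Type := Lp (Act T) 2 (volume : Measure unitInterval)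

/-- The box `[0, M+1]^T`. -/
def box (T : ℕ) (M : ℝ) : Set (Act T) := {x | ∀ t, x t ∈ Icc (0 : ℝ) (M + 1)}

/-- The set of subgradients at `x` of a function `φ` with domain `C`. -/
def subdifferential {T : ℕ} (C : Set (Act T)) (φ : Act T → ℝ) (x : Act T) : Set (Act T) :=
  {g | x ∈ C ∧ ∀ z ∈ C, φ x + inner ℝ g (z - x) ≤ φ z}

/-- A nonatomic aggregative game with player set `[0,1]` and actions in `ℝ^T`.
`actions θ` is the set of feasible pure actions of player `θ`, `cost θ x Y` is the cost of
player `θ` at own action `x` and aggregate action `Y`, and the costs have domain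
`dom × dom`; values of `cost` outside the domain play no role. -/
structure NonatomicGame (T : ℕ) where
  actions : unitInterval → Set (Act T)
  dom : Set (Act T)
  cost : unitInterval → Act T → Act T → ℝ

namespace NonatomicGame

variable {T : ℕ} (G : NonatomicGame T)

/-- The subdifferential of the cost of player `θ` with respect to the own action. -/
def partialSubdiff (θ : unitInterval) (x Y : Act T) : Set (Act T) :=
  subdifferential G.dom (fun z => G.cost θ z Y) x

/-- The aggregate action of a profile. -/
def aggregate (x : Profile T) : Act T := ∫ θ, x θ

/-- The set of feasible pure-action profiles. -/
def profiles : Set (Profile T) := {x | ∀ᵐ θ, x θ ∈ G.actions θ}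

/-- The set of feasible aggregate actions. -/
def aggregates : Set (Act T) := {Y | ∃ x ∈ G.profiles, aggregate x = Y}

/-- The feasible pure-action profiles whose aggregate lies in `A`. -/
def constrainedProfiles (A : Set (Act T)) : Set (Profile T) :=
  {x | x ∈ G.profiles ∧ aggregate x ∈ A}

/-- The correspondence `H`: square-integrable selections of subgradients along a profile. -/
def H (x : Profile T) : Set (Profile T) :=
  {g | ∀ᵐ θ, g θ ∈ G.partialSubdiff θ (x θ) (aggregate x)}

/-- Nonempty convex compact action sets with Borel graph, contained in the closed ball of
radius `M` and in the box `[0, M+1]^T`. -/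
structure ActionAssumption (M : ℝ) : Prop where
  nonempty : ∀ θ, (G.actions θ).Nonempty
  convex : ∀ θ, Convex ℝ (G.actions θ)
  isCompact : ∀ θ, IsCompact (G.actions θ)
  measurable_graph : MeasurableSet {p : unitInterval × Act T | p.2 ∈ G.actions p.1}
  subset_ball : ∀ θ, G.actions θ ⊆ Metric.closedBall 0 M
  subset_box : ∀ θ, G.actions θ ⊆ box T M

/-- The domain is a neighborhood of the box; costs are bounded on the box, Lebesgue measurable
in the player, continuous and convex in the own action, with uniformly bounded subgradients. -/
structure CostAssumption (M : ℝ) : Prop where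
  dom_nhds : G.dom ∈ 𝓝ˢ (box T M)
  bounded : ∀ θ, ∃ C : ℝ, ∀ x ∈ box T M, ∀ Y ∈ box T M, |G.cost θ x Y| ≤ C
  measurable : ∀ Y ∈ box T M, ∀ x ∈ box T M, AEMeasurable (fun θ => G.cost θ x Y) volume
  continuousOn : ∀ Y ∈ box T M, ∀ θ, ContinuousOn (fun x => G.cost θ x Y) G.dom
  convexOn : ∀ Y ∈ box T M, ∀ θ, ConvexOn ℝ G.dom (fun x => G.cost θ x Y)
  subgradient_bound : ∃ B : ℝ, 0 < B ∧ ∀ θ, ∀ x ∈ box T M, ∀ Y ∈ box T M,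
    ∀ g ∈ G.partialSubdiff θ x Y, ‖g‖ ≤ B

/-- Continuity of the costs in the aggregate action. -/
def AggregateContinuity (M : ℝ) : Prop :=
  ∀ θ, ∀ x ∈ box T M, ContinuousOn (fun Y => G.cost θ x Y) (box T M)

/-- Monotonicity of the game on a set `K` of profiles. -/
def MonotoneOnProfiles (K : Set (Profile T)) : Prop :=
  ∀ x ∈ K, ∀ y ∈ K, ∀ g ∈ G.H x, ∀ h ∈ G.H y,
    0 ≤ ∫ θ, inner ℝ (g θ - h θ) (x θ - y θ)

/-- `x` is a variational Wardrop equilibrium of the game with aggregative constraint `A`. -/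
def IsVWE (A : Set (Act T)) (x : Profile T) : Prop :=
  x ∈ G.constrainedProfiles A ∧
    ∃ g ∈ G.H x, ∀ y ∈ G.constrainedProfiles A, 0 ≤ ∫ θ, inner ℝ (g θ) (y θ - x θ)

end NonatomicGame

end

/-! The argument is Minty's method followed by a minimax interchange. Monotonicity and weak
compactness of the feasible set K of profiles give x in K with ⟨h, z - x⟩ ≥ 0 for all z in K and h
in H(z) (`exists_minty_solution`). Passing to a strong solution does not use upper semicontinuity of
H. Test at z_t = (1 - t)x + ty: the subgradient inequality bounds ⟨h, y - z_t⟩ by a difference of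
costs at the aggregate of z_t, and t → 0 shows that x minimizes over K the total cost with the
aggregate frozen at that of x (`integral_cost_sub_nonneg_of_minty`). That frozen problem is convex,
so each y in K has some g in H(x) with ⟨g, y - x⟩ ≥ 0 (`exists_subgradient_inner_nonneg`). Since
H(x) is convex and weakly compact, one g serves every y (`exists_forall_inner_nonneg`).

The remaining difficulty is to find measurable subgradients. Proximal points over the box are unique
minimizers, hence measurable, and carry explicit subgradients relative to the box. Near a profile
pulled towards the centre of the box they are interior, so these are subgradients on the whole
domain; weak compactness brings them back to the original profile. -/

/-- A finite-dimensional theorem of the alternative: a convex set that meets every half-space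
`{q | 0 ≤ ∑ μ i * q i}` with weights `μ` in the simplex comes arbitrarily close to the
nonnegative orthant. -/
theorem Convex.exists_forall_neg_lt {ι : Type*} [Fintype ι] {Q : Set (ι → ℝ)}
    (hQ : Convex ℝ Q) (hne : Q.Nonempty)
    (h : ∀ μ ∈ stdSimplex ℝ ι, ∃ q ∈ Q, 0 ≤ ∑ i, μ i * q i) {ε : ℝ} (hε : 0 < ε) :
    ∃ q ∈ Q, ∀ i, -ε < q i := by
  classical
  by_contra! hcon
  have hO : {q : ι → ℝ | ∀ i, -ε < q i} = univ.pi fun _ => Ioi (-ε) := by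
    ext; simp [mem_pi]
  obtain ⟨f, u, hfo, hfq⟩ := geometric_hahn_banach_open (s := {q : ι → ℝ | ∀ i, -ε < q i}) (t := Q)
    (by rw [hO]; exact convex_pi fun _ _ => convex_Ioi _)
    (by rw [hO]; exact isOpen_set_pi finite_univ fun _ _ => isOpen_Ioi) hQ
    (Set.disjoint_left.2 fun q hq hqQ => by
      obtain ⟨i, hi⟩ := hcon q hqQ
      exact absurd (hq i) (not_lt.2 hi))
  have hu : 0 < u := by
    have := hfo 0 (fun i => by simpa using hε)
    simpa using this
  have hf : ∀ q, f q = ∑ i, q i * f (Pi.single i 1) := fun q => by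
    conv_lhs => rw [pi_eq_sum_univ' q]
    simp [map_sum]
  -- The orthant recedes along `Pi.single i 1` while `f < u` on it. Were the coefficient positive,
  -- the multiple used here would give `f` exactly the value `u`.
  have hneg : ∀ i, f (Pi.single i 1) ≤ 0 := by
    intro i
    by_contra! hpos
    have hN : 0 ≤ u / f (Pi.single i 1) := by positivity
    have := hfo ((u / f (Pi.single i 1)) • Pi.single i 1) (fun j => by
      rcases eq_or_ne j i with rfl | hj
      · simp; linarith
      · simp [hj, hε])
    rw [map_smul, smul_eq_mul, div_mul_cancel₀ _ hpos.ne'] at this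
    exact lt_irrefl _ this
  set σ := ∑ i, -f (Pi.single i 1) with hσ
  have hσ0 : 0 ≤ σ := Finset.sum_nonneg fun i _ => by linarith [hneg i]
  -- If `σ = 0`, then `f` vanishes, against `0 < u ≤ f` on `Q`. Otherwise `-f / σ` is a point of the
  -- simplex, and `h` yields some `q` in `Q` with `f q ≤ 0 < u`.
  rcases hσ0.eq_or_lt with h0 | hpos
  · obtain ⟨q, hq⟩ := hne
    have hz := (Finset.sum_eq_zero_iff_of_nonneg (fun i _ => by linarith [hneg i])).1 h0.symm
    have : f q = 0 := by
      rw [hf]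
      exact Finset.sum_eq_zero fun i hi => by rw [neg_eq_zero.1 (hz i hi), mul_zero]
    linarith [hfq q hq]
  · obtain ⟨q, hq, hq0⟩ := h (fun i => -f (Pi.single i 1) / σ)
      ⟨fun i => div_nonneg (by linarith [hneg i]) hσ0, by
        rw [← Finset.sum_div, ← hσ, div_self hpos.ne']⟩
    have : ∑ i, -f (Pi.single i 1) / σ * q i = -f q / σ := by
      rw [hf, ← Finset.sum_neg_distrib, Finset.sum_div]
      exact Finset.sum_congr rfl fun i _ => by ring
    rw [this, le_div_iff₀ hpos, zero_mul] at hq0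
    linarith [hfq q hq]

theorem sub_combo {V : Type*} [AddCommGroup V] [Module ℝ V] (y a b : V) {s t : ℝ}
    (hst : s + t = 1) : y - (s • a + t • b) = s • (y - a) + t • (y - b) := by
  conv_lhs => rw [← one_smul ℝ y, ← hst]
  module

/-! ### Weak compactness, Minty solutions and minimax in Hilbert space -/

section Hilbert

variable {F : Type*} [NormedAddCommGroup F] [InnerProductSpace ℝ F] [CompleteSpace F]

/-- Weak compactness of bounded closed convex sets, as a finite intersection property. -/
theorem nonempty_iInter_of_finite_of_convex {ι : Type*} {C : ι → Set F} {K : Set F} {R : ℝ}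
    (hKcl : IsClosed K) (hKc : Convex ℝ K) (hKR : K ⊆ Metric.closedBall 0 R)
    (hcl : ∀ i, IsClosed (C i)) (hc : ∀ i, Convex ℝ (C i))
    (hfin : ∀ u : Finset ι, (K ∩ ⋂ i ∈ u, C i).Nonempty) : (K ∩ ⋂ i, C i).Nonempty := by
  let Φ : WeakDual ℝ F → F := fun φ => (InnerProductSpace.toDual ℝ F).symm φ.toStrongDual
  let Ψ : F → WeakDual ℝ F := fun x => (InnerProductSpace.toDual ℝ F x).toWeakDual
  have hΦΨ : ∀ x, Φ (Ψ x) = x := fun x => by simp [Φ, Ψ]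
  have hin : ∀ φ w, inner ℝ (Φ φ) w = φ w := fun φ w => by
    simp [Φ]
  -- Hahn–Banach separates a point outside `D` by a half-space, and half-spaces are weak-* open
  -- through evaluation at the Riesz vector `w`. Compactness below is Banach–Alaoglu.
  have hclosed : ∀ D : Set F, IsClosed D → Convex ℝ D → IsClosed (Φ ⁻¹' D) := by
    intro D hD hDc
    rw [← isOpen_compl_iff, isOpen_iff_forall_mem_open]
    intro φ hφ
    obtain ⟨f, u, hfu, hux⟩ := geometric_hahn_banach_closed_point hDc hD hφ
    set w := (InnerProductSpace.toDual ℝ F).symm f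
    have hf : ∀ x, f x = inner ℝ x w := fun x => by
      rw [real_inner_comm]; simp [w]
    refine ⟨{ψ | u < ψ w}, fun ψ hψ hψD => ?_, ?_, ?_⟩
    · have := hfu _ hψD
      rw [hf, hin] at this
      exact lt_asymm this hψ
    · exact isOpen_lt continuous_const (WeakDual.eval_continuous w)
    · rw [hf, hin] at hux
      exact hux
  have hcpt : IsCompact (Φ ⁻¹' K) := by
    refine (WeakDual.isCompact_closedBall (𝕜 := ℝ) (E := F) 0 R).of_isClosed_subset
      (hclosed K hKcl hKc) fun φ hφ => ?_
    have := hKR hφ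
    simpa [Φ] using this
  obtain ⟨φ, hφK, hφ⟩ := hcpt.inter_iInter_nonempty (fun i => Φ ⁻¹' C i)
    (fun i => hclosed _ (hcl i) (hc i)) fun u => by
      obtain ⟨x, hxK, hx⟩ := hfin u
      refine ⟨Ψ x, by simpa [hΦΨ] using hxK, ?_⟩
      simpa [hΦΨ] using hx
  exact ⟨Φ φ, hφK, by simpa using hφ⟩

/-- The existence half of Minty's lemma: a monotone relation `P` on a bounded closed convex set
has a solution of the weak variational inequality. -/
theorem exists_minty_solution {K : Set F} {R : ℝ} (hKcl : IsClosed K) (hKc : Convex ℝ K)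
    (hKR : K ⊆ Metric.closedBall 0 R) (hne : K.Nonempty) {P : Set (F × F)}
    (hPK : ∀ p ∈ P, p.1 ∈ K)
    (hmono : ∀ p ∈ P, ∀ q ∈ P, 0 ≤ inner ℝ (p.2 - q.2) (p.1 - q.1)) :
    ∃ x ∈ K, ∀ p ∈ P, 0 ≤ inner ℝ p.2 (p.1 - x) := by
  -- The second index is a slack: the theorem of the alternative only comes close to the orthant. It
  -- is sent to zero at the end.
  obtain ⟨x, hxK, hx⟩ := nonempty_iInter_of_finite_of_convex (ι := P × Set.Ioi (0 : ℝ))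
    (C := fun i => {x | -(i.2 : ℝ) ≤ inner ℝ i.1.1.2 (i.1.1.1 - x)}) hKcl hKc hKR
    (fun i => isClosed_le continuous_const (by fun_prop))
    (fun i => by
      intro a ha b hb s t hs ht hst
      simp only [mem_ofPred_eq] at ha hb ⊢
      rw [sub_combo _ _ _ hst, inner_add_right, inner_smul_right, inner_smul_right]
      have : -(i.2 : ℝ) = s * -(i.2 : ℝ) + t * -(i.2 : ℝ) := by rw [← add_mul, hst, one_mul]
      rw [this]
      gcongr)
    (fun u => by
      classical
      obtain ⟨ε, hε, hεu⟩ : ∃ ε : ℝ, 0 < ε ∧ ∀ i ∈ u, ε ≤ i.2 := by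
        rcases u.eq_empty_or_nonempty with rfl | hu
        · exact ⟨1, one_pos, by simp⟩
        · obtain ⟨i, hi, him⟩ := u.exists_min_image (fun i => (i.2 : ℝ)) hu
          exact ⟨i.2, i.2.2, him⟩
      obtain ⟨q, ⟨x, hx, rfl⟩, hq⟩ := Convex.exists_forall_neg_lt (ι := u)
        (Q := (fun x (i : u) => inner ℝ i.1.1.1.2 (i.1.1.1.1 - x)) '' K) (by
          rintro _ ⟨a, ha, rfl⟩ _ ⟨b, hb, rfl⟩ s t hs ht hst
          refine ⟨s • a + t • b, hKc ha hb hs ht hst, ?_⟩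
          funext i
          simp [sub_combo _ _ _ hst, inner_add_right, inner_smul_right]) (hne.image _) (by
          intro μ hμ
          -- At the barycentre of the first components the weighted sum is a double sum; symmetrized
          -- in `i` and `j`, its terms are the monotonicity products.
          refine ⟨_, ⟨∑ j, μ j • j.1.1.1.1, ?_, rfl⟩, ?_⟩
          · exact hKc.sum_mem (fun i _ => hμ.1 i) hμ.2 fun i _ => hPK _ i.1.1.2
          have e : ∀ i : u, μ i * inner ℝ i.1.1.1.2 (i.1.1.1.1 - ∑ j, μ j • j.1.1.1.1)
              = ∑ j : u, μ i * μ j * inner ℝ i.1.1.1.2 (i.1.1.1.1 - j.1.1.1.1) := by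
            intro i
            have : i.1.1.1.1 - ∑ j, μ j • j.1.1.1.1
                = ∑ j, μ j • (i.1.1.1.1 - j.1.1.1.1) := by
              simp_rw [smul_sub, Finset.sum_sub_distrib, ← Finset.sum_smul, hμ.2, one_smul]
            rw [this, inner_sum, Finset.mul_sum]
            exact Finset.sum_congr rfl fun j _ => by rw [inner_smul_right]; ring
          simp only [e]
          have hs : ∑ i : u, ∑ j : u, μ i * μ j * inner ℝ i.1.1.1.2 (i.1.1.1.1 - j.1.1.1.1)
              = ∑ i : u, ∑ j : u, μ i * μ j * inner ℝ j.1.1.1.2 (j.1.1.1.1 - i.1.1.1.1) := by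
            rw [Finset.sum_comm]
            exact Finset.sum_congr rfl fun i _ => Finset.sum_congr rfl fun j _ => by ring
          have h2 : 0 ≤ ∑ i : u, ∑ j : u, (μ i * μ j * inner ℝ i.1.1.1.2 (i.1.1.1.1 - j.1.1.1.1)
              + μ i * μ j * inner ℝ j.1.1.1.2 (j.1.1.1.1 - i.1.1.1.1)) := by
            refine Finset.sum_nonneg fun i _ => Finset.sum_nonneg fun j _ => ?_
            have := hmono _ i.1.1.2 _ j.1.1.2
            rw [← mul_add]
            refine mul_nonneg (mul_nonneg (hμ.1 i) (hμ.1 j)) ?_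
            rw [inner_sub_left] at this
            rw [← neg_sub i.1.1.1.1 j.1.1.1.1, inner_neg_right]
            linarith
          simp only [Finset.sum_add_distrib] at h2
          linarith) hε
      refine ⟨x, hx, mem_iInter₂.2 fun i hi => ?_⟩
      have := hq ⟨i, hi⟩
      have := hεu i hi
      simp only [mem_ofPred_eq]
      linarith)
  refine ⟨x, hxK, fun p hp => le_of_forall_pos_le_add fun ε hε => ?_⟩
  have := mem_iInter.1 hx (⟨p, hp⟩, ⟨ε, hε⟩)
  simp only [mem_ofPred_eq] at this
  linarith

/-- A minimax theorem for the inner product: if every `v` in a convex set `V` makes a nonnegative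
product with some element of the bounded closed convex set `S`, then one element of `S` serves
all of `V`. -/
theorem exists_forall_inner_nonneg {S V : Set F} {R : ℝ} (hScl : IsClosed S) (hSc : Convex ℝ S)
    (hSR : S ⊆ Metric.closedBall 0 R) (hne : S.Nonempty) (hV : Convex ℝ V)
    (h : ∀ v ∈ V, ∃ g ∈ S, 0 ≤ inner ℝ g v) : ∃ g ∈ S, ∀ v ∈ V, 0 ≤ inner ℝ g v := by
  obtain ⟨x, hxK, hx⟩ := nonempty_iInter_of_finite_of_convex (ι := V × Set.Ioi (0 : ℝ))
    (C := fun i => {x | -(i.2 : ℝ) ≤ inner ℝ x i.1.1}) hScl hSc hSR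
    (fun i => isClosed_le continuous_const (by fun_prop))
    (fun i => by
      intro a ha b hb s t hs ht hst
      simp only [mem_ofPred_eq] at ha hb ⊢
      rw [inner_add_left, real_inner_smul_left, real_inner_smul_left]
      have : -(i.2 : ℝ) = s * -(i.2 : ℝ) + t * -(i.2 : ℝ) := by rw [← add_mul, hst, one_mul]
      rw [this]
      gcongr)
    (fun u => by
      classical
      obtain ⟨ε, hε, hεu⟩ : ∃ ε : ℝ, 0 < ε ∧ ∀ i ∈ u, ε ≤ i.2 := by
        rcases u.eq_empty_or_nonempty with rfl | hu
        · exact ⟨1, one_pos, by simp⟩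
        · obtain ⟨i, hi, him⟩ := u.exists_min_image (fun i => (i.2 : ℝ)) hu
          exact ⟨i.2, i.2.2, him⟩
      obtain ⟨q, ⟨x, hx, rfl⟩, hq⟩ := Convex.exists_forall_neg_lt (ι := u)
        (Q := (fun x (i : u) => inner ℝ x i.1.1.1) '' S) (by
          rintro _ ⟨a, ha, rfl⟩ _ ⟨b, hb, rfl⟩ s t hs ht hst
          refine ⟨s • a + t • b, hSc ha hb hs ht hst, ?_⟩
          funext i
          simp [inner_add_left, real_inner_smul_left]) (hne.image _) (by
          intro μ hμ
          obtain ⟨g, hg, hg0⟩ := h (∑ j, μ j • j.1.1.1)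
            (hV.sum_mem (fun i _ => hμ.1 i) hμ.2 fun i _ => i.1.1.2)
          refine ⟨_, ⟨g, hg, rfl⟩, ?_⟩
          simpa [inner_sum, inner_smul_right] using hg0) hε
      refine ⟨x, hx, mem_iInter₂.2 fun i hi => ?_⟩
      have := hq ⟨i, hi⟩
      have := hεu i hi
      simp only [mem_ofPred_eq]
      linarith)
  refine ⟨x, hxK, fun v hv => le_of_forall_pos_le_add fun ε hε => ?_⟩
  have := mem_iInter.1 hx (⟨v, hv⟩, ⟨ε, hε⟩)
  simp only [mem_ofPred_eq] at this
  linarith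

end Hilbert

/-! ### Pointwise constraints in L² -/

section Lp

variable {Ω E : Type*} [MeasurableSpace Ω] {μ : Measure Ω} [NormedAddCommGroup E]
  {C : Ω → Set E}

/-- Convergence in L² implies convergence in measure, hence almost everywhere along a subsequence.
-/
theorem isClosed_setOf_ae_mem (hC : ∀ θ, IsClosed (C θ)) :
    IsClosed {h : Lp E 2 μ | ∀ᵐ θ ∂μ, h θ ∈ C θ} := by
  refine IsSeqClosed.isClosed fun u h hu hlim => ?_
  obtain ⟨ns, -, hns⟩ := (tendstoInMeasure_of_tendsto_Lp hlim).exists_seq_tendsto_ae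
  have hall : ∀ᵐ θ ∂μ, ∀ n, u n θ ∈ C θ := ae_all_iff.2 hu
  filter_upwards [hns, hall] with θ h1 h2
  exact (hC θ).mem_of_tendsto h1 (Filter.Eventually.of_forall fun n => h2 _)

theorem convex_setOf_ae_mem [NormedSpace ℝ E] (hC : ∀ θ, Convex ℝ (C θ)) :
    Convex ℝ {h : Lp E 2 μ | ∀ᵐ θ ∂μ, h θ ∈ C θ} := by
  intro a ha b hb s t hs ht hst
  filter_upwards [ha, hb, Lp.coeFn_add (s • a) (t • b), Lp.coeFn_smul s a, Lp.coeFn_smul t b]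
    with θ h1 h2 h3 h4 h5
  rw [h3, Pi.add_apply, h4, h5]
  exact hC θ h1 h2 hs ht hst

end Lp

/-! ### Proximal points and their measurability -/

theorem IsCompact.exists_prox {E : Type*} [NormedAddCommGroup E] {K : Set E} {φ : E → ℝ}
    (hK : IsCompact K) (hne : K.Nonempty) (hc : ContinuousOn φ K) (κ : ℝ) (x : E) :
    ∃ p ∈ K, ∀ y ∈ K, φ p + κ * ‖x - p‖ ^ 2 ≤ φ y + κ * ‖x - y‖ ^ 2 :=
  hK.exists_isMinOn hne (hc.add (by fun_prop))

section Prox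

variable {E : Type*} [NormedAddCommGroup E] [InnerProductSpace ℝ E] {K : Set E} {φ : E → ℝ}

theorem nonneg_of_forall_mem_Ioc_add_mul_nonneg {a b : ℝ}
    (h : ∀ s ∈ Ioc (0 : ℝ) 1, 0 ≤ a + s * b) : 0 ≤ a := by
  have ht : Filter.Tendsto (fun s : ℝ => a + s * b) (𝓝[>] 0) (𝓝 a) := by
    have : Filter.Tendsto (fun s : ℝ => a + s * b) (𝓝 0) (𝓝 (a + 0 * b)) :=
      Continuous.tendsto (by fun_prop) 0
    rw [zero_mul, add_zero] at this
    exact this.mono_left nhdsWithin_le_nhds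
  exact ge_of_tendsto ht (Filter.eventually_of_mem (Ioc_mem_nhdsGT one_pos) h)

/-- A minimizer of `z ↦ φ z + κ * ‖x - z‖ ^ 2` on `K` yields the subgradient `2 κ (x - p)`. -/
theorem ConvexOn.add_inner_le_of_prox (hφ : ConvexOn ℝ K φ) {κ : ℝ} {x p z : E} (hp : p ∈ K)
    (hmin : ∀ y ∈ K, φ p + κ * ‖x - p‖ ^ 2 ≤ φ y + κ * ‖x - y‖ ^ 2) (hz : z ∈ K) :
    φ p + inner ℝ ((2 * κ) • (x - p)) (z - p) ≤ φ z := by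
  rw [real_inner_smul_left, ← sub_nonneg]
  -- Compare `p` with `(1 - s) • p + s • z`, divide by `s`, and let `s` tend to zero.
  refine nonneg_of_forall_mem_Ioc_add_mul_nonneg (b := κ * ‖z - p‖ ^ 2) fun s hs => ?_
  have hs1 : 0 ≤ 1 - s := sub_nonneg.2 hs.2
  have h1 := hmin _ (hφ.1 hp hz hs1 hs.1.le (by ring))
  have h2 := hφ.2 hp hz hs1 hs.1.le (by ring)
  have h3 : ‖x - ((1 - s) • p + s • z)‖ ^ 2
      = ‖x - p‖ ^ 2 - 2 * (s * inner ℝ (x - p) (z - p)) + s ^ 2 * ‖z - p‖ ^ 2 := by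
    have : x - ((1 - s) • p + s • z) = (x - p) - s • (z - p) := by module
    rw [this, norm_sub_sq_real, inner_smul_right, norm_smul, mul_pow, Real.norm_eq_abs, sq_abs]
  rw [h3] at h1
  simp only [smul_eq_mul] at h2
  refine nonneg_of_mul_nonneg_right (a := s) ?_ hs.1
  linarith

/-- Quadratic growth, from the strong convexity of the penalty: near-minimizers are close to the
minimizer. Minimizing sequences therefore converge to it. -/
theorem ConvexOn.mul_norm_sub_sq_le_of_prox (hφ : ConvexOn ℝ K φ) {κ : ℝ} {x p z : E} (hp : p ∈ K)
    (hmin : ∀ y ∈ K, φ p + κ * ‖x - p‖ ^ 2 ≤ φ y + κ * ‖x - y‖ ^ 2) (hz : z ∈ K) :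
    κ * ‖z - p‖ ^ 2 ≤ (φ z + κ * ‖x - z‖ ^ 2) - (φ p + κ * ‖x - p‖ ^ 2) := by
  have h1 := hφ.add_inner_le_of_prox hp hmin hz
  have h2 : ‖x - z‖ ^ 2 = ‖x - p‖ ^ 2 - 2 * inner ℝ (x - p) (z - p) + ‖z - p‖ ^ 2 := by
    rw [← norm_sub_sq_real]; congr 2; abel
  rw [real_inner_smul_left] at h1
  rw [h2]
  linarith

/-- Measurability of the proximal point. -/
theorem exists_aestronglyMeasurable_prox {Ω : Type*} [MeasurableSpace Ω] {μ : Measure Ω}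
    [SecondCountableTopology E] [MeasurableSpace E] [BorelSpace E]
    (hK : IsCompact K) (hne : K.Nonempty) {φ : Ω → E → ℝ}
    (hc : ∀ θ, ContinuousOn (φ θ) K) (hconv : ∀ θ, ConvexOn ℝ K (φ θ))
    (hm : ∀ z ∈ K, AEMeasurable (fun θ => φ θ z) μ) {w : Ω → E} (hw : AEMeasurable w μ)
    {κ : ℝ} (hκ : 0 < κ) :
    ∃ p : Ω → E, AEStronglyMeasurable p μ ∧ ∀ θ, p θ ∈ K ∧
      ∀ y ∈ K, φ θ (p θ) + κ * ‖w θ - p θ‖ ^ 2 ≤ φ θ y + κ * ‖w θ - y‖ ^ 2 := by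
  choose p hpK hp using fun θ => hK.exists_prox hne (hc θ) κ (w θ)
  refine ⟨p, ?_, fun θ => ⟨hpK θ, hp θ⟩⟩
  have : Nonempty K := hne.to_subtype
  let z : ℕ → K := TopologicalSpace.denseSeq K
  have hψ : ∀ i, AEMeasurable (fun θ => φ θ (z i) + κ * ‖w θ - z i‖ ^ 2) μ := fun i =>
    (hm _ (z i).2).add (((hw.sub_const _).norm.pow_const 2).const_mul κ)
  let ψ : ℕ → Ω → ℝ := fun i => (hψ i).mk
  have hψm : ∀ i, Measurable (ψ i) := fun i => (hψ i).measurable_mk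
  -- `r k` is the best of the first `k + 1` points of the dense sequence, paired with its value. It
  -- is measurable because `ψ` consists of measurable modifications of the objective.
  let r : ℕ → Ω → E × ℝ := fun k => Nat.rec (fun θ => ((z 0 : E), ψ 0 θ))
    (fun k rk θ => if ψ (k + 1) θ < (rk θ).2 then ((z (k + 1) : E), ψ (k + 1) θ) else rk θ) k
  have hr : ∀ k θ, r (k + 1) θ
      = if ψ (k + 1) θ < (r k θ).2 then ((z (k + 1) : E), ψ (k + 1) θ) else r k θ :=
    fun _ _ => rfl
  have hrm : ∀ k, Measurable (r k) := by
    intro k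
    induction k with
    | zero => exact measurable_const.prodMk (hψm 0)
    | succ k ih =>
      exact Measurable.ite (measurableSet_lt (hψm _) ih.snd)
        (measurable_const.prodMk (hψm _)) ih
  have hrz : ∀ k θ, ∃ i, r k θ = ((z i : E), ψ i θ) := by
    intro k θ
    induction k with
    | zero => exact ⟨0, rfl⟩
    | succ k ih =>
      rw [hr]
      split_ifs
      · exact ⟨_, rfl⟩
      · exact ih
  have hrle : ∀ k θ, ∀ i ≤ k, (r k θ).2 ≤ ψ i θ := by
    intro k θ
    induction k with
    | zero => intro i hi; exact (congrArg (ψ · θ) (Nat.le_zero.1 hi)).ge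
    | succ k ih =>
      intro i hi
      rw [hr]
      rcases hi.lt_or_eq with hi | rfl
      · have := ih i (Nat.lt_succ_iff.1 hi)
        split_ifs with h
        · exact h.le.trans this
        · exact this
      · split_ifs with h
        · exact le_rfl
        · exact not_lt.1 h
  refine aestronglyMeasurable_of_tendsto_ae Filter.atTop (f := fun k θ => (r k θ).1)
    (fun k => (hrm k).fst.aestronglyMeasurable) ?_
  have hgood : ∀ᵐ θ ∂μ, ∀ i, φ θ (z i) + κ * ‖w θ - z i‖ ^ 2 = ψ i θ :=
    ae_all_iff.2 fun i => (hψ i).ae_eq_mk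
  filter_upwards [hgood] with θ hθ
  have hcont : Continuous fun y : K => φ θ y + κ * ‖w θ - y‖ ^ 2 := by
    have := continuousOn_iff_continuous_domRestrict.1 (hc θ)
    exact this.add (by fun_prop)
  rw [Metric.tendsto_atTop]
  intro ε hε
  -- Some dense point has value within `κ * ε ^ 2` of the minimum; by quadratic growth all later
  -- best points lie within `ε` of `p θ`.
  obtain ⟨i, hi⟩ := (TopologicalSpace.denseRange_denseSeq K).exists_mem_open
    (isOpen_lt hcont (continuous_const (y := φ θ (p θ) + κ * ‖w θ - p θ‖ ^ 2 + κ * ε ^ 2)))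
    ⟨⟨p θ, hpK θ⟩, by simp; positivity⟩
  refine ⟨i, fun k hk => ?_⟩
  obtain ⟨j, hj⟩ := hrz k θ
  have h1 := (hconv θ).mul_norm_sub_sq_le_of_prox (hpK θ) (hp θ) (z j).2
  have h2 := hrle k θ i hk
  have h3 : φ θ (z i) + κ * ‖w θ - z i‖ ^ 2
      < φ θ (p θ) + κ * ‖w θ - p θ‖ ^ 2 + κ * ε ^ 2 := hi
  rw [hj] at h2 ⊢
  rw [hθ j] at h1
  rw [hθ i] at h3
  simp only at h2 ⊢
  rw [dist_eq_norm]
  have h4 : κ * ‖(z j : E) - p θ‖ ^ 2 < κ * ε ^ 2 := by linarith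
  exact lt_of_pow_lt_pow_left₀ 2 hε.le (lt_of_mul_lt_mul_left h4 hκ.le)

end Prox

/-! ### Subgradients and Lipschitz bounds on the box -/

section Box

variable {T : ℕ} {M : ℝ}

theorem convex_box : Convex ℝ (box T M) := by
  intro x hx y hy a b ha hb hab t
  have := convex_Icc (0 : ℝ) (M + 1) (hx t) (hy t) ha hb hab
  simpa using this

theorem isCompact_box : IsCompact (box T M) := by
  have : box T M = (EuclideanSpace.equiv (Fin T) ℝ).toHomeomorph ⁻¹'
      univ.pi fun _ => Icc (0 : ℝ) (M + 1) := by
    ext x; simp [box, mem_pi, -pi_univ_Icc]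
  rw [this]
  exact (Homeomorph.isCompact_preimage _).2 (isCompact_univ_pi fun _ => isCompact_Icc)

theorem box_mem_nhds {p : Act T} (hp : ∀ t, p t ∈ Ioo (0 : ℝ) (M + 1)) : box T M ∈ 𝓝 p := by
  have : ∀ᶠ x in 𝓝 p, ∀ t, x t ∈ Ioo (0 : ℝ) (M + 1) :=
    Filter.eventually_all.2 fun t =>
      (Continuous.continuousAt (f := fun x : Act T => x t) (by fun_prop)).eventually
        (isOpen_Ioo.mem_nhds (hp t))
  filter_upwards [this] with x hx t using Ioo_subset_Icc_self (hx t)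

/-- The centre of the box `[0, M+1]^T`. -/
noncomputable def boxCenter (T : ℕ) (M : ℝ) : Act T := WithLp.toLp 2 fun _ => (M + 1) / 2

theorem boxCenter_mem (hM : 0 < M) : boxCenter T M ∈ box T M := fun t => by
  simp only [boxCenter, mem_Icc]
  constructor <;> linarith

/-- Moving a fraction `s` towards the centre leaves a margin of `s * ((M + 1) / 2)` to every face.
-/
theorem box_mem_nhds_of_norm_sub_lt {x p : Act T} (hx : x ∈ box T M) {s : ℝ} (hs : s ≤ 1)
    (hp : ‖p - ((1 - s) • x + s • boxCenter T M)‖ < s * ((M + 1) / 2)) : box T M ∈ 𝓝 p := by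
  refine box_mem_nhds fun t => ?_
  have h1 := (PiLp.norm_apply_le (p - ((1 - s) • x + s • boxCenter T M)) t).trans_lt hp
  have h2 : (p - ((1 - s) • x + s • boxCenter T M)) t
      = p t - ((1 - s) * x t + s * ((M + 1) / 2)) := by simp [boxCenter]
  rw [h2, Real.norm_eq_abs, abs_lt] at h1
  have h3 := mul_nonneg (sub_nonneg.2 hs) (hx t).1
  have h4 := mul_le_mul_of_nonneg_left (hx t).2 (sub_nonneg.2 hs)
  constructor <;> linarith [h1.1, h1.2]

variable {D : Set (Act T)} {φ : Act T → ℝ}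

/-- A local minimum of the convex function `φ - ⟨g, ·⟩` is global. Thus a proximal inequality known
only on the box suffices at interior points. -/
theorem mem_subdifferential_of_mem_nhds (hφ : ConvexOn ℝ D φ) {K : Set (Act T)} {p g : Act T}
    (hp : p ∈ D) (hK : K ∈ 𝓝 p) (h : ∀ z ∈ K, φ p + inner ℝ g (z - p) ≤ φ z) :
    g ∈ subdifferential D φ p := by
  refine ⟨hp, fun z hz => ?_⟩
  have hconv : ConvexOn ℝ D fun z => φ z - inner ℝ g z :=
    hφ.sub ⟨hφ.1, fun x _ y _ a b _ _ _ => by simp [inner_add_right, inner_smul_right]⟩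
  have hmin : IsLocalMinOn (fun z => φ z - inner ℝ g z) D p := by
    refine Filter.eventually_of_mem (mem_nhdsWithin_of_mem_nhds hK) fun z hz => ?_
    have := h z hz
    rw [inner_sub_right] at this
    show φ p - inner ℝ g p ≤ φ z - inner ℝ g z
    linarith
  have := IsMinOn.of_isLocalMinOn_of_convexOn hp hmin hconv hz
  simp only [mem_ofPred_eq] at this
  rw [inner_sub_right]
  linarith

/-- A convex function whose subgradients on the box are bounded by `B` is `B`-Lipschitz there. -/
theorem sub_le_mul_norm_sub_of_subgradient_bound (hM : 0 < M) (hD : D ∈ 𝓝ˢ (box T M))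
    (hc : ContinuousOn φ D) (hφ : ConvexOn ℝ D φ) {B : ℝ}
    (hB : ∀ x ∈ box T M, ∀ g ∈ subdifferential D φ x, ‖g‖ ≤ B) {x z : Act T}
    (hx : x ∈ box T M) (hz : z ∈ box T M) : φ x - φ z ≤ B * ‖x - z‖ := by
  have hsub : box T M ⊆ D := subset_of_mem_nhdsSet hD
  have hcb := hc.mono hsub
  have hφb := hφ.subset hsub convex_box
  obtain ⟨C, hC⟩ := isCompact_box.exists_bound_of_continuousOn hcb
  -- For interior `x`, proximal points with weight `n + 1` tend to `x`, since `φ` is bounded on the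
  -- box. Eventually they are interior, so their subgradients obey the bound `B`.
  have hint : ∀ x, box T M ∈ 𝓝 x → φ x - φ z ≤ B * ‖x - z‖ := by
    intro x hx
    have hxb := mem_of_mem_nhds hx
    choose p hpb hp using fun n : ℕ =>
      isCompact_box.exists_prox ⟨x, hxb⟩ hcb ((n : ℝ) + 1) x
    have hlim : Filter.Tendsto p Filter.atTop (𝓝 x) := by
      rw [tendsto_iff_norm_sub_tendsto_zero]
      have h0 : Filter.Tendsto (fun n : ℕ => √(2 * C * (1 / ((n : ℝ) + 1)))) Filter.atTop
          (𝓝 0) := by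
        have := (tendsto_one_div_add_atTop_nhds_zero_nat (𝕜 := ℝ)).const_mul (2 * C)
        rw [mul_zero] at this
        simpa [Function.comp_def] using (Real.continuous_sqrt.tendsto 0).comp (by simpa using this)
      refine squeeze_zero (fun _ => norm_nonneg _) (fun n => Real.le_sqrt_of_sq_le ?_) h0
      have h1 := hp n x hxb
      have h2 := (abs_le.1 (hC _ (hpb n))).1
      have h3 := (abs_le.1 (hC _ hxb)).2
      rw [sub_self, norm_zero, norm_sub_rev] at h1
      rw [mul_one_div, le_div_iff₀ (by positivity)]
      nlinarith
    have hev : ∀ᶠ n in Filter.atTop, φ (p n) - φ z ≤ B * ‖p n - z‖ := by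
      filter_upwards [hlim.eventually (eventually_mem_nhds_iff.2 hx)] with n hn
      have hg := mem_subdifferential_of_mem_nhds hφ (hsub (hpb n)) hn fun y hy =>
        hφb.add_inner_le_of_prox (hpb n) (hp n) hy
      have h1 := hg.2 z (hsub hz)
      have h2 := (abs_le.1 (abs_real_inner_le_norm
        ((2 * ((n : ℝ) + 1)) • (x - p n)) (z - p n))).1
      have h3 := mul_le_mul_of_nonneg_right (hB _ (hpb n) _ hg) (norm_nonneg (z - p n))
      rw [norm_sub_rev (p n) z]
      linarith
    refine le_of_tendsto_of_tendsto ?_ ?_ hev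
    · exact (((hc.continuousAt (Filter.mem_of_superset hx hsub)).tendsto).comp hlim).sub_const _
    · exact ((hlim.sub_const z).norm).const_mul B
  -- Boundary points are reached from the interior along the segment to the centre.
  let γ : ℝ → Act T := fun s => (1 - s) • x + s • boxCenter T M
  have hγ : Filter.Tendsto γ (𝓝[>] 0) (𝓝 x) := by
    have : Filter.Tendsto γ (𝓝 0) (𝓝 (γ 0)) := Continuous.tendsto (by fun_prop) 0
    simp only [γ, sub_zero, one_smul, zero_smul, add_zero] at this
    exact this.mono_left nhdsWithin_le_nhds
  refine le_of_tendsto_of_tendsto (b := 𝓝[>] (0 : ℝ)) (f := fun s => φ (γ s) - φ z)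
    (g := fun s => B * ‖γ s - z‖) ?_ ?_ ?_
  · have hxD : D ∈ 𝓝 x := mem_nhdsSet_iff_forall.1 hD x hx
    exact (((hc.continuousAt hxD).tendsto).comp hγ).sub_const _
  · exact ((hγ.sub_const z).norm).const_mul B
  · filter_upwards [Ioc_mem_nhdsGT one_pos] with s hs
    refine hint _ (box_mem_nhds_of_norm_sub_lt hx hs.2 ?_)
    rw [sub_self, norm_zero]
    exact mul_pos hs.1 (by linarith)

end Box

theorem convex_subdifferential {T : ℕ} {D : Set (Act T)} {φ : Act T → ℝ} {x : Act T} :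
    Convex ℝ (subdifferential D φ x) := by
  intro g hg h hh a b ha hb hab
  refine ⟨hg.1, fun z hz => ?_⟩
  have h1 := mul_le_mul_of_nonneg_left (hg.2 z hz) ha
  have h2 := mul_le_mul_of_nonneg_left (hh.2 z hz) hb
  rw [inner_add_left, real_inner_smul_left, real_inner_smul_left]
  calc φ x + (a * inner ℝ g (z - x) + b * inner ℝ h (z - x))
      = a * (φ x + inner ℝ g (z - x)) + b * (φ x + inner ℝ h (z - x))
        + (1 - (a + b)) * φ x := by ring
    _ ≤ a * φ z + b * φ z + (1 - (a + b)) * φ x := by gcongr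
    _ = φ z := by rw [hab, ← add_mul, hab]; ring

theorem isClosed_subdifferential {T : ℕ} {D : Set (Act T)} {φ : Act T → ℝ} {x : Act T} :
    IsClosed (subdifferential D φ x) := by
  have : subdifferential D φ x
      = {_g | x ∈ D} ∩ ⋂ z ∈ D, {g | φ x + inner ℝ g (z - x) ≤ φ z} := by
    ext g; simp [subdifferential]
  rw [this]
  exact isClosed_const.inter
    (isClosed_biInter fun z _ => isClosed_le (by fun_prop) continuous_const)

/-! ### Profiles, aggregates and integrals -/

namespace NonatomicGame

variable {T : ℕ} {G : NonatomicGame T} {M B : ℝ}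

theorem Profile.integrable (x : Profile T) : Integrable x :=
  (Lp.memLp x).integrable one_le_two

theorem mem_closedBall_of_ae {R : ℝ} (hR : 0 ≤ R) {g : Profile T}
    (h : ∀ᵐ θ, g θ ∈ Metric.closedBall 0 R) : g ∈ Metric.closedBall 0 R := by
  rw [mem_closedBall_zero_iff]
  have h2 : ∀ᵐ θ, ‖g θ‖ ≤ R := by
    filter_upwards [h] with θ hθ using mem_closedBall_zero_iff.1 hθ
  simpa [measureUnivNNReal] using Lp.norm_le_of_ae_bound hR h2

theorem inner_sub_eq_integral (g x y : Profile T) :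
    inner ℝ g (y - x) = ∫ θ, inner ℝ (g θ) (y θ - x θ) := by
  rw [L2.inner_def]
  refine integral_congr_ae ?_
  filter_upwards [Lp.coeFn_sub y x] with θ h
  rw [h, Pi.sub_apply]

theorem integrable_inner_sub (g x y : Profile T) :
    Integrable fun θ => inner ℝ (g θ) (y θ - x θ) := by
  refine (L2.integrable_inner g (y - x)).congr ?_
  filter_upwards [Lp.coeFn_sub y x] with θ h
  rw [h, Pi.sub_apply]

theorem coeFn_combo (x y : Profile T) (a b : ℝ) :
    ∀ᵐ θ, (a • x + b • y) θ = a • x θ + b • y θ := by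
  filter_upwards [Lp.coeFn_add (a • x) (b • y), Lp.coeFn_smul a x, Lp.coeFn_smul b y]
    with θ h1 h2 h3
  rw [h1, Pi.add_apply, h2, h3, Pi.smul_apply, Pi.smul_apply]

theorem aggregate_combo (x y : Profile T) (a b : ℝ) :
    aggregate (a • x + b • y) = a • aggregate x + b • aggregate y := by
  unfold aggregate
  rw [integral_congr_ae (coeFn_combo x y a b),
    ← integral_smul, ← integral_smul]
  exact integral_add ((Profile.integrable x).smul a) ((Profile.integrable y).smul b)

theorem continuous_aggregate : Continuous (aggregate (T := T)) := by
  refine LipschitzWith.continuous (K := 1) (LipschitzWith.of_dist_le_mul fun x y => ?_)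
  have h : aggregate x - aggregate y = ∫ θ, (x - y : Profile T) θ := by
    unfold aggregate
    rw [← integral_sub (Profile.integrable x) (Profile.integrable y)]
    refine integral_congr_ae ?_
    filter_upwards [Lp.coeFn_sub x y] with θ h
    rw [h, Pi.sub_apply]
  rw [NNReal.coe_one, one_mul, dist_eq_norm, dist_eq_norm, h]
  refine (norm_integral_le_integral_norm _).trans ?_
  rw [integral_norm_eq_lintegral_enorm (Lp.aestronglyMeasurable _), ← eLpNorm_one_eq_lintegral_enorm,
    Lp.norm_def]
  exact ENNReal.toReal_mono (Lp.eLpNorm_ne_top _)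
    (eLpNorm_le_eLpNorm_of_exponent_le one_le_two (Lp.aestronglyMeasurable _))

theorem aggregate_mem_box {x : Profile T} (hx : ∀ᵐ θ, x θ ∈ box T M) : aggregate x ∈ box T M :=
  convex_box.integral_mem isCompact_box.isClosed hx (Profile.integrable x)

theorem exists_forall_norm_sub_le (T : ℕ) (M : ℝ) :
    ∃ D : ℝ, 0 < D ∧ ∀ x ∈ box T M, ∀ y ∈ box T M, ‖x - y‖ ≤ D := by
  obtain ⟨D, hD⟩ := Metric.isBounded_iff.1 (isCompact_box (T := T) (M := M)).isBounded
  exact ⟨max D 1, lt_max_of_lt_right one_pos, fun x hx y hy => by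
    rw [← dist_eq_norm]; exact (hD hx hy).trans (le_max_left _ _)⟩

/-- Uniform bound on the subgradients at points of the box. -/
def SubgradientBound (G : NonatomicGame T) (M B : ℝ) : Prop :=
  0 < B ∧ ∀ θ, ∀ x ∈ box T M, ∀ Y ∈ box T M, ∀ g ∈ G.partialSubdiff θ x Y, ‖g‖ ≤ B

/-! ### Measurable selections of subgradients -/

namespace CostAssumption

theorem box_subset_dom (hf : G.CostAssumption M) : box T M ⊆ G.dom :=
  subset_of_mem_nhdsSet hf.dom_nhds

theorem abs_sub_le (hM : 0 < M) (hf : G.CostAssumption M) (hB : G.SubgradientBound M B)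
    {Y : Act T} (hY : Y ∈ box T M) (θ : unitInterval) {x z : Act T} (hx : x ∈ box T M)
    (hz : z ∈ box T M) : |G.cost θ x Y - G.cost θ z Y| ≤ B * ‖x - z‖ := by
  have key := fun {x z : Act T} (hx : x ∈ box T M) (hz : z ∈ box T M) =>
    sub_le_mul_norm_sub_of_subgradient_bound hM hf.dom_nhds (hf.continuousOn Y hY θ)
      (hf.convexOn Y hY θ) (fun x hx g hg => hB.2 θ x hx Y hY g hg) hx hz
  have h2 := key hz hx
  rw [norm_sub_rev] at h2
  exact abs_sub_le_iff.2 ⟨key hx hz, h2⟩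

/-- By the Lipschitz bound, the cost is the infimum over a dense sequence of the cones `G.cost θ (z
i) Y + B * ‖w θ - z i‖`, which only need measurability at fixed actions. -/
theorem aemeasurable_cost (hM : 0 < M) (hf : G.CostAssumption M) (hB : G.SubgradientBound M B)
    {Y : Act T} (hY : Y ∈ box T M) {w : unitInterval → Act T} (hw : AEMeasurable w)
    (hwb : ∀ᵐ θ, w θ ∈ box T M) : AEMeasurable fun θ => G.cost θ (w θ) Y := by
  have : Nonempty (box T M) := ⟨⟨_, boxCenter_mem hM⟩⟩
  let z : ℕ → box T M := TopologicalSpace.denseSeq (box T M)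
  have hm : AEMeasurable fun θ => ⨅ i, (G.cost θ (z i) Y + B * ‖w θ - z i‖) :=
    AEMeasurable.iInf fun i => (hf.measurable Y hY _ (z i).2).add
      ((hw.sub_const _).norm.const_mul B)
  refine hm.congr ?_
  filter_upwards [hwb] with θ hθ
  refine ciInf_eq_of_forall_ge_of_forall_gt_exists_lt (fun i => ?_) fun b hb => ?_
  · have := (abs_le.1 (hf.abs_sub_le hM hB hY θ hθ (z i).2)).2
    linarith
  · have hcont : Continuous fun v : box T M => G.cost θ v Y + B * ‖w θ - v‖ := by
      have := continuousOn_iff_continuous_domRestrict.1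
        ((hf.continuousOn Y hY θ).mono hf.box_subset_dom)
      exact this.add (by fun_prop)
    exact (TopologicalSpace.denseRange_denseSeq (box T M)).exists_mem_open
      (isOpen_lt hcont continuous_const) ⟨⟨w θ, hθ⟩, by simpa using hb⟩

/-- The bound on the cost itself may vary with `θ`, but the Lipschitz constant `B` does not; hence
only differences are integrated. -/
theorem integrable_cost_sub (hM : 0 < M) (hf : G.CostAssumption M)
    (hB : G.SubgradientBound M B) {Y : Act T} (hY : Y ∈ box T M) {v w : unitInterval → Act T}
    (hv : AEMeasurable v) (hw : AEMeasurable w) (hvb : ∀ᵐ θ, v θ ∈ box T M)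
    (hwb : ∀ᵐ θ, w θ ∈ box T M) :
    Integrable fun θ => G.cost θ (v θ) Y - G.cost θ (w θ) Y := by
  obtain ⟨D, -, hD⟩ := exists_forall_norm_sub_le T M
  refine Integrable.of_bound ((hf.aemeasurable_cost hM hB hY hv hvb).sub
    (hf.aemeasurable_cost hM hB hY hw hwb)).aestronglyMeasurable (B * D) ?_
  filter_upwards [hvb, hwb] with θ h1 h2
  exact (hf.abs_sub_le hM hB hY θ h1 h2).trans
    (mul_le_mul_of_nonneg_left (hD _ h1 _ h2) hB.1.le)

/-- Measurable subgradients exist at points arbitrarily close to a given profile. These points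
are interior to the box, where the box determines the subdifferential. -/
theorem exists_subgradient_near (hM : 0 < M) (hf : G.CostAssumption M)
    (hB : G.SubgradientBound M B) {Y : Act T} (hY : Y ∈ box T M) {w : unitInterval → Act T}
    (hw : AEMeasurable w) (hwb : ∀ᵐ θ, w θ ∈ box T M) {r : ℝ} (hr : 0 < r) :
    ∃ (g : Profile T) (p : unitInterval → Act T), ∀ᵐ θ, p θ ∈ box T M ∧ ‖p θ - w θ‖ ≤ r ∧
      g θ ∈ G.partialSubdiff θ (p θ) Y := by
  obtain ⟨D, hD0, hD⟩ := exists_forall_norm_sub_le T M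
  obtain ⟨s, hs0, hs1, hsr⟩ : ∃ s : ℝ, 0 < s ∧ s ≤ 1 ∧ s * D ≤ r / 2 :=
    ⟨min 1 (r / 2 / D), by positivity, min_le_left _ _, by
      rw [← le_div_iff₀ hD0]; exact min_le_right _ _⟩
  -- `m` keeps the proximal step below `r / 2` and inside the margin to the faces. With `κ = 2 * B /
  -- m`, a step of length `d` satisfies `κ * d ^ 2 ≤ B * d`, so `d ≤ m / 2`.
  set m := min (r / 2) (s * ((M + 1) / 2)) with hm
  have hm0 : 0 < m := by positivity
  set κ := 2 * B / m with hκ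
  have hκ0 : 0 < κ := div_pos (mul_pos two_pos hB.1) hm0
  let x' : unitInterval → Act T := fun θ => (1 - s) • w θ + s • boxCenter T M
  have hx' : AEMeasurable x' := (hw.const_smul (1 - s)).add_const _
  obtain ⟨p, hpm, hp⟩ := exists_aestronglyMeasurable_prox (μ := volume)
    (φ := fun θ z => G.cost θ z Y) isCompact_box ⟨_, boxCenter_mem hM⟩
    (fun θ => (hf.continuousOn Y hY θ).mono hf.box_subset_dom)
    (fun θ => (hf.convexOn Y hY θ).subset hf.box_subset_dom convex_box)
    (hf.measurable Y hY) hx' hκ0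
  have hgood : ∀ᵐ θ, ‖p θ - w θ‖ ≤ r ∧
      (2 * κ) • (x' θ - p θ) ∈ G.partialSubdiff θ (p θ) Y := by
    filter_upwards [hwb] with θ hθ
    have hx'b : x' θ ∈ box T M :=
      convex_box hθ (boxCenter_mem hM) (sub_nonneg.2 hs1) hs0.le (by ring)
    have h1 := (hp θ).2 _ hx'b
    have h2 := (abs_le.1 (hf.abs_sub_le hM hB hY θ hx'b (hp θ).1)).2
    have h3 : ‖x' θ - p θ‖ < m := by
      by_contra! hle
      rw [sub_self, norm_zero] at h1
      have h5 : κ * m = 2 * B := by rw [hκ]; field_simp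
      have h6 : κ * ‖x' θ - p θ‖ ^ 2 ≤ B * ‖x' θ - p θ‖ := by
        linarith
      have h7 : 0 < ‖x' θ - p θ‖ := hm0.trans_le hle
      have h8 : κ * ‖x' θ - p θ‖ ≤ B := by
        refine le_of_mul_le_mul_right ?_ h7
        linarith
      have h9 := mul_le_mul_of_nonneg_left hle hκ0.le
      linarith [hB.1]
    refine ⟨?_, ?_⟩
    · have e : p θ - w θ = (p θ - x' θ) + s • (boxCenter T M - w θ) := by
        simp only [x']; module
      rw [e]
      refine (norm_add_le _ _).trans ?_
      rw [norm_sub_rev, norm_smul, Real.norm_eq_abs, abs_of_pos hs0]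
      have h4 := mul_le_mul_of_nonneg_left (hD _ (boxCenter_mem hM) _ hθ) hs0.le
      have h5 := h3.le.trans (min_le_left _ _)
      linarith
    · refine mem_subdifferential_of_mem_nhds (hf.convexOn Y hY θ)
        (hf.box_subset_dom (hp θ).1) (box_mem_nhds_of_norm_sub_lt hθ hs1 ?_) fun z hz =>
          ((hf.convexOn Y hY θ).subset hf.box_subset_dom convex_box).add_inner_le_of_prox
            (hp θ).1 (hp θ).2 hz
      rw [norm_sub_rev]
      exact h3.trans_le (min_le_right _ _)
  have hmem : MemLp (fun θ => (2 * κ) • (x' θ - p θ)) 2 (volume : Measure unitInterval) := by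
    refine MemLp.of_bound ((hx'.aestronglyMeasurable.sub hpm).const_smul (2 * κ)) B ?_
    filter_upwards [hgood] with θ hθ using hB.2 θ _ (hp θ).1 Y hY _ hθ.2
  refine ⟨hmem.toLp _, p, ?_⟩
  filter_upwards [hgood, hmem.coeFn_toLp] with θ h1 h2
  rw [h2]
  exact ⟨(hp θ).1, h1⟩

/-- Approximate form of `exists_subgradient_inner_nonneg`. -/
theorem exists_approx_subgradient (hM : 0 < M) (hf : G.CostAssumption M)
    (hB : G.SubgradientBound M B) {Y : Act T} (hY : Y ∈ box T M) {x y : Profile T}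
    (hx : ∀ᵐ θ, x θ ∈ box T M) (hy : ∀ᵐ θ, y θ ∈ box T M)
    (hmin : ∀ t ∈ Ioo (0 : ℝ) 1,
      0 ≤ ∫ θ, (G.cost θ ((1 - t) • x θ + t • y θ) Y - G.cost θ (x θ) Y))
    {ε : ℝ} (hε : 0 < ε) :
    ∃ g : Profile T, (∀ᵐ θ, g θ ∈ Metric.closedBall 0 B ∩
      {h | ∀ z ∈ G.dom, G.cost θ (x θ) Y + inner ℝ h (z - x θ) - ε ≤ G.cost θ z Y}) ∧
      -ε ≤ inner ℝ g (y - x) := by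
  obtain ⟨D, hD0, hD⟩ := exists_forall_norm_sub_le T M
  have hB0 := hB.1
  obtain ⟨t, ht0, ht1, hte⟩ : ∃ t : ℝ, 0 < t ∧ t < 1 ∧ t * (2 * B * (1 + D)) ≤ ε :=
    ⟨min (1 / 2) (ε / (2 * B * (1 + D))), by positivity,
      (min_le_left _ _).trans_lt (by norm_num), by
      rw [← le_div_iff₀ (by positivity)]; exact min_le_right _ _⟩
  set w : unitInterval → Act T := fun θ => (1 - t) • x θ + t • y θ with hw
  have hxm : AEMeasurable x := (Lp.aestronglyMeasurable x).aemeasurable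
  have hym : AEMeasurable y := (Lp.aestronglyMeasurable y).aemeasurable
  have hwm : AEMeasurable w := (hxm.const_smul (1 - t)).add (hym.const_smul t)
  have hwb : ∀ᵐ θ, w θ ∈ box T M := by
    filter_upwards [hx, hy] with θ h1 h2
    exact convex_box h1 h2 (sub_nonneg.2 ht1.le) ht0.le (by ring)
  -- The tolerance `t ^ 2` is of second order, so the error is still of order `t` after the division
  -- by `t` in the second estimate.
  obtain ⟨g, p, hgp⟩ := hf.exists_subgradient_near hM hB hY hwm hwb (r := t ^ 2) (by positivity)
  have htt : t ^ 2 ≤ t := by nlinarith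
  refine ⟨g, ?_, ?_⟩
  · filter_upwards [hgp, hx, hy] with θ ⟨hpb, hpw, hg⟩ h1 h2
    have hgB := hB.2 θ _ hpb Y hY _ hg
    refine ⟨by simpa using hgB, fun z hz => ?_⟩
    have e : p θ - x θ = (p θ - w θ) + t • (y θ - x θ) := by simp only [w]; module
    have h3 : ‖p θ - x θ‖ ≤ t * (1 + D) := by
      rw [e]
      refine (norm_add_le _ _).trans ?_
      rw [norm_smul, Real.norm_eq_abs, abs_of_pos ht0]
      have := mul_le_mul_of_nonneg_left (hD _ h2 _ h1) ht0.le
      linarith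
    have h4 := hg.2 z hz
    have h5 := (abs_le.1 (hf.abs_sub_le hM hB hY θ hpb h1)).1
    have h6 := (abs_le.1 (abs_real_inner_le_norm (g θ) (p θ - x θ))).2
    have h7 := mul_le_mul_of_nonneg_right hgB (norm_nonneg (p θ - x θ))
    have h8 := mul_le_mul_of_nonneg_left h3 hB0.le
    have h9 : z - p θ = (z - x θ) - (p θ - x θ) := by abel
    rw [h9, inner_sub_right] at h4
    simp only at h4
    linarith
  · have hpt : ∀ᵐ θ, (G.cost θ (w θ) Y - G.cost θ (x θ) Y) - 2 * B * t ^ 2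
        ≤ t * inner ℝ (g θ) (y θ - x θ) := by
      filter_upwards [hgp, hx, hwb] with θ ⟨hpb, hpw, hg⟩ h1 h2
      have hgB := hB.2 θ _ hpb Y hY _ hg
      have h4 := hg.2 (x θ) (hf.box_subset_dom h1)
      have h5 := (abs_le.1 (hf.abs_sub_le hM hB hY θ hpb h2)).1
      have h6 := (abs_le.1 (abs_real_inner_le_norm (g θ) (p θ - w θ))).2
      have h7 := mul_le_mul hgB hpw (norm_nonneg _) hB0.le
      have h8 := mul_le_mul_of_nonneg_left hpw hB0.le
      have e : x θ - p θ = -(t • (y θ - x θ)) - (p θ - w θ) := by simp only [w]; module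
      rw [e, inner_sub_right, inner_neg_right, inner_smul_right] at h4
      simp only at h4
      linarith
    have hint := hf.integrable_cost_sub hM hB hY hwm hxm hwb hx
    have h1 := integral_mono_ae (hint.sub (integrable_const (2 * B * t ^ 2)))
      ((integrable_inner_sub g x y).const_mul t) hpt
    rw [integral_sub' hint (integrable_const _), integral_const, probReal_univ, one_smul,
      integral_const_mul t, ← inner_sub_eq_integral] at h1
    have h2 := hmin t ⟨ht0, ht1⟩
    have h3 : t * (-(2 * B * t)) ≤ t * inner ℝ g (y - x) := by
      calc t * (-(2 * B * t)) = 0 - 2 * B * t ^ 2 := by ring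
        _ ≤ _ := (sub_le_sub_right h2 _).trans h1
    have h4 := le_of_mul_le_mul_left h3 ht0
    have h5 : 0 ≤ t * (2 * B * D) := by positivity
    linarith

/-- First-order condition: if moving from `x` towards `y` does not decrease the total cost at
the fixed aggregate `Y`, then some measurable selection of subgradients makes a nonnegative
product with `y - x`. -/
theorem exists_subgradient_inner_nonneg (hM : 0 < M) (hf : G.CostAssumption M)
    (hB : G.SubgradientBound M B) {Y : Act T} (hY : Y ∈ box T M) {x y : Profile T}
    (hx : ∀ᵐ θ, x θ ∈ box T M) (hy : ∀ᵐ θ, y θ ∈ box T M)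
    (hmin : ∀ t ∈ Ioo (0 : ℝ) 1,
      0 ≤ ∫ θ, (G.cost θ ((1 - t) • x θ + t • y θ) Y - G.cost θ (x θ) Y)) :
    ∃ g : Profile T, (∀ᵐ θ, g θ ∈ G.partialSubdiff θ (x θ) Y) ∧ 0 ≤ inner ℝ g (y - x) := by
  -- These sets of approximate solutions are bounded, closed, convex and nested; weak compactness
  -- gives a point common to all `ε = 1 / (n + 1)`.
  let S : ℝ → Set (Profile T) := fun ε => {g | (∀ᵐ θ, g θ ∈ Metric.closedBall 0 B ∩
      {h | ∀ z ∈ G.dom, G.cost θ (x θ) Y + inner ℝ h (z - x θ) - ε ≤ G.cost θ z Y})} ∩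
      {g | -ε ≤ inner ℝ g (y - x)}
  have hSmono : ∀ {ε δ : ℝ}, ε ≤ δ → S ε ⊆ S δ := by
    rintro ε δ h g ⟨h1, h2⟩
    rw [mem_ofPred_eq] at h1
    exact ⟨h1.mono fun θ hθ =>
      ⟨hθ.1, fun z hz => (sub_le_sub_left h _).trans (hθ.2 z hz)⟩, (neg_le_neg h).trans h2⟩
  have hSball : ∀ ε, S ε ⊆ Metric.closedBall 0 B := by
    rintro ε g ⟨h1, -⟩
    rw [mem_ofPred_eq] at h1
    exact mem_closedBall_of_ae hB.1.le (h1.mono fun θ hθ => hθ.1)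
  have hSne : ∀ ε, 0 < ε → (S ε).Nonempty := fun ε hε => by
    obtain ⟨g, h1, h2⟩ := hf.exists_approx_subgradient hM hB hY hx hy hmin hε
    exact ⟨g, h1, h2⟩
  have hcl : ∀ ε, IsClosed (S ε) := fun ε => by
    refine (isClosed_setOf_ae_mem fun θ => Metric.isClosed_closedBall.inter ?_).inter
      (isClosed_le continuous_const (by fun_prop))
    have : {h | ∀ z ∈ G.dom, G.cost θ (x θ) Y + inner ℝ h (z - x θ) - ε ≤ G.cost θ z Y}
        = ⋂ z ∈ G.dom, {h | G.cost θ (x θ) Y + inner ℝ h (z - x θ) - ε ≤ G.cost θ z Y} := by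
      ext; simp
    rw [this]
    exact isClosed_biInter fun z _ => isClosed_le (by fun_prop) continuous_const
  have hlin : ∀ {V : Type} [NormedAddCommGroup V] [InnerProductSpace ℝ V] (v : V),
      IsLinearMap ℝ fun h : V => inner ℝ h v := fun v =>
    ⟨fun a b => inner_add_left a b v, fun c a => real_inner_smul_left a v c⟩
  have hcv : ∀ ε, Convex ℝ (S ε) := fun ε => by
    refine (convex_setOf_ae_mem fun θ => (convex_closedBall _ _).inter ?_).inter
      (convex_halfSpace_ge (hlin _) _)
    have : {h | ∀ z ∈ G.dom, G.cost θ (x θ) Y + inner ℝ h (z - x θ) - ε ≤ G.cost θ z Y}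
        = ⋂ z ∈ G.dom, {h | inner ℝ h (z - x θ) ≤ G.cost θ z Y + ε - G.cost θ (x θ) Y} := by
      ext h
      simp only [mem_ofPred_eq, mem_iInter]
      exact forall₂_congr fun z _ => ⟨fun h => by linarith, fun h => by linarith⟩
    rw [this]
    exact convex_iInter₂ fun z _ => convex_halfSpace_le (hlin _) _
  obtain ⟨g, -, hg⟩ := nonempty_iInter_of_finite_of_convex
    (C := fun n : ℕ => S (1 / ((n : ℝ) + 1))) (K := Metric.closedBall 0 B)
    Metric.isClosed_closedBall (convex_closedBall _ _) subset_rfl (fun _ => hcl _)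
    (fun _ => hcv _) fun u => by
      obtain ⟨g, hg⟩ := hSne (1 / ((u.sup id : ℕ) + 1)) (by positivity)
      exact ⟨g, hSball _ hg, mem_iInter₂.2 fun n hn => hSmono
        (one_div_le_one_div_of_le (by positivity)
          (by gcongr; exact Finset.le_sup (f := id) hn)) hg⟩
  have hg' := mem_iInter.1 hg
  have hall : ∀ᵐ θ, ∀ n : ℕ, ∀ z ∈ G.dom,
      G.cost θ (x θ) Y + inner ℝ (g θ) (z - x θ) - 1 / ((n : ℝ) + 1) ≤ G.cost θ z Y :=
    ae_all_iff.2 fun n => by filter_upwards [(hg' n).1] with θ hθ using hθ.2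
  have hzero := tendsto_one_div_add_atTop_nhds_zero_nat (𝕜 := ℝ)
  refine ⟨g, ?_, ?_⟩
  · filter_upwards [hall, hx] with θ h1 h2
    refine ⟨hf.box_subset_dom h2, fun z hz => ?_⟩
    have := hzero.const_sub (G.cost θ (x θ) Y + inner ℝ (g θ) (z - x θ))
    rw [sub_zero] at this
    exact le_of_tendsto' this fun n => h1 n z hz
  · have := hzero.neg
    rw [neg_zero] at this
    exact le_of_tendsto' this fun n => (hg' n).2

end CostAssumption

end NonatomicGame

/-! ### From the weak variational inequality to equilibrium -/

namespace NonatomicGame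

variable {T : ℕ} {G : NonatomicGame T} {M B : ℝ} {A : Set (Act T)}

theorem convex_constrainedProfiles (hX : G.ActionAssumption M) (hA : Convex ℝ A) :
    Convex ℝ (G.constrainedProfiles A) := by
  intro x hx y hy a b ha hb hab
  refine ⟨convex_setOf_ae_mem hX.convex hx.1 hy.1 ha hb hab, ?_⟩
  rw [aggregate_combo]
  exact hA hx.2 hy.2 ha hb hab

theorem isClosed_constrainedProfiles (hX : G.ActionAssumption M) (hA : IsClosed A) :
    IsClosed (G.constrainedProfiles A) :=
  (isClosed_setOf_ae_mem fun θ => (hX.isCompact θ).isClosed).inter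
    (hA.preimage continuous_aggregate)

theorem ActionAssumption.ae_mem_box (hX : G.ActionAssumption M) {x : Profile T}
    (hx : x ∈ G.constrainedProfiles A) : ∀ᵐ θ, x θ ∈ box T M :=
  Filter.Eventually.mono hx.1 fun θ hθ => hX.subset_box θ hθ

/-- The first-order condition with `y = x`, where its hypothesis is trivial. -/
theorem H_nonempty (hM : 0 < M) (hf : G.CostAssumption M) (hB : G.SubgradientBound M B)
    {x : Profile T} (hx : ∀ᵐ θ, x θ ∈ box T M) : (G.H x).Nonempty := by
  obtain ⟨g, hg, -⟩ := hf.exists_subgradient_inner_nonneg hM hB (aggregate_mem_box hx) hx hx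
    fun t _ => integral_nonneg fun θ => by
      rw [← add_smul, sub_add_cancel, one_smul, sub_self]; rfl
  exact ⟨g, hg⟩

/-- A solution of the weak variational inequality minimizes the total cost at its own aggregate. -/
theorem integral_cost_sub_nonneg_of_minty (hM : 0 < M) (hX : G.ActionAssumption M)
    (hf : G.CostAssumption M) (hc : G.AggregateContinuity M) (hB : G.SubgradientBound M B)
    (hA : Convex ℝ A) {x y : Profile T} (hx : x ∈ G.constrainedProfiles A)
    (hy : y ∈ G.constrainedProfiles A)
    (hminty : ∀ z ∈ G.constrainedProfiles A, ∀ h ∈ G.H z, 0 ≤ inner ℝ h (z - x)) :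
    0 ≤ ∫ θ, (G.cost θ (y θ) (aggregate x) - G.cost θ (x θ) (aggregate x)) := by
  have hxb := hX.ae_mem_box hx
  have hyb := hX.ae_mem_box hy
  have hxm : AEMeasurable x := (Lp.aestronglyMeasurable x).aemeasurable
  have hym : AEMeasurable y := (Lp.aestronglyMeasurable y).aemeasurable
  obtain ⟨D, hD0, hD⟩ := exists_forall_norm_sub_le T M
  let w : ℝ → unitInterval → Act T := fun t θ => (1 - t) • x θ + t • y θ
  let Y : ℝ → Act T := fun t => (1 - t) • aggregate x + t • aggregate y
  have hwm : ∀ t, AEMeasurable (w t) := fun t => (hxm.const_smul (1 - t)).add (hym.const_smul t)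
  have hwb : ∀ t ∈ Ioo (0 : ℝ) 1, ∀ θ, x θ ∈ box T M → y θ ∈ box T M → w t θ ∈ box T M :=
    fun t ht θ h1 h2 => convex_box h1 h2 (sub_nonneg.2 ht.2.le) ht.1.le (by ring)
  have hYb : ∀ t ∈ Ioo (0 : ℝ) 1, Y t ∈ box T M := fun t ht =>
    convex_box (aggregate_mem_box hxb) (aggregate_mem_box hyb) (sub_nonneg.2 ht.2.le) ht.1.le
      (by ring)
  have htend : ∀ {V : Type} [NormedAddCommGroup V] [NormedSpace ℝ V] (a b : V),
      Filter.Tendsto (fun t : ℝ => (1 - t) • a + t • b) (𝓝[>] 0) (𝓝 a) := by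
    intro V _ _ a b
    have : Filter.Tendsto (fun t : ℝ => (1 - t) • a + t • b) (𝓝 0)
        (𝓝 ((1 - (0 : ℝ)) • a + (0 : ℝ) • b)) := Continuous.tendsto (by fun_prop) 0
    simp only [sub_zero, one_smul, zero_smul, add_zero] at this
    exact this.mono_left nhdsWithin_le_nhds
  have hsmall : ∀ᶠ t in 𝓝[>] (0 : ℝ), t ∈ Ioo (0 : ℝ) 1 := Ioo_mem_nhdsGT one_pos
  have hYt : Filter.Tendsto Y (𝓝[>] 0) (𝓝[box T M] (aggregate x)) :=
    tendsto_nhdsWithin_iff.2 ⟨htend _ _, hsmall.mono hYb⟩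
  -- Both `z - x` and `y - z` are positive multiples of `y - x`, so the weak inequality at `z` also
  -- gives a nonnegative product with `y - z`.
  have hnonneg : ∀ t ∈ Ioo (0 : ℝ) 1,
      0 ≤ ∫ θ, (G.cost θ (y θ) (Y t) - G.cost θ (w t θ) (Y t)) := by
    intro t ht
    set z : Profile T := (1 - t) • x + t • y with hz
    have hzK : z ∈ G.constrainedProfiles A :=
      convex_constrainedProfiles hX hA hx hy (sub_nonneg.2 ht.2.le) ht.1.le (by ring)
    have hzY : aggregate z = Y t := aggregate_combo _ _ _ _
    obtain ⟨h, hh⟩ := H_nonempty hM hf hB (hX.ae_mem_box hzK)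
    have h1 := hminty z hzK h hh
    have e1 : z - x = t • (y - x) := by rw [hz]; module
    have e2 : y - z = (1 - t) • (y - x) := by rw [hz]; module
    rw [e1, inner_smul_right] at h1
    have h2 : 0 ≤ inner ℝ h (y - z) := by
      rw [e2, inner_smul_right]
      exact mul_nonneg (sub_nonneg.2 ht.2.le) (nonneg_of_mul_nonneg_right h1 ht.1)
    rw [inner_sub_eq_integral] at h2
    refine h2.trans (integral_mono_ae (integrable_inner_sub h z y)
      (hf.integrable_cost_sub hM hB (hYb t ht) hym (hwm t) hyb ?_) ?_)
    · filter_upwards [hxb, hyb] with θ using hwb t ht θ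
    · filter_upwards [hh, hyb, coeFn_combo x y (1 - t) t] with θ h3 h4 h5
      have := h3.2 (y θ) (hf.box_subset_dom h4)
      rw [hzY] at this
      have h6 : z θ = w t θ := h5
      rw [h6] at this ⊢
      simp only at this ⊢
      linarith
  refine ge_of_tendsto (tendsto_integral_filter_of_dominated_convergence
    (F := fun t θ => G.cost θ (y θ) (Y t) - G.cost θ (w t θ) (Y t)) (fun _ => B * D) ?_ ?_
    (integrable_const _) ?_) (hsmall.mono hnonneg)
  · filter_upwards [hsmall] with t ht
    refine (hf.integrable_cost_sub hM hB (hYb t ht) hym (hwm t) hyb ?_).aestronglyMeasurable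
    filter_upwards [hxb, hyb] with θ using hwb t ht θ
  · filter_upwards [hsmall] with t ht
    filter_upwards [hxb, hyb] with θ h1 h2
    have h3 := hwb t ht θ h1 h2
    exact (hf.abs_sub_le hM hB (hYb t ht) θ h2 h3).trans
      (mul_le_mul_of_nonneg_left (hD _ h2 _ h3) hB.1.le)
  · filter_upwards [hxb, hyb] with θ h1 h2
    have hlimy := (hc θ _ h2 _ (aggregate_mem_box hxb)).tendsto.comp hYt
    have hlimx := (hc θ _ h1 _ (aggregate_mem_box hxb)).tendsto.comp hYt
    refine hlimy.sub ?_
    -- Joint continuity is not assumed: the Lipschitz bound, uniform in the aggregate, absorbs the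
    -- motion of the own action.
    have hdiff : Filter.Tendsto (fun t => G.cost θ (w t θ) (Y t) - G.cost θ (x θ) (Y t))
        (𝓝[>] 0) (𝓝 0) := by
      have h0 := (((htend (x θ) (y θ)).sub_const (x θ)).norm).const_mul B
      rw [sub_self, norm_zero, mul_zero] at h0
      refine squeeze_zero_norm' ?_ h0
      filter_upwards [hsmall] with t ht
      exact hf.abs_sub_le hM hB (hYb t ht) θ (hwb t ht θ h1 h2) h1
    have := hdiff.add hlimx
    rw [zero_add] at this
    exact this.congr fun t => by simp

end NonatomicGame

open NonatomicGame

theorem mainTheorem2 (T : ℕ) (hT : 0 < T) (G : NonatomicGame T) (M : ℝ) (hM : 0 < M)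
    (hX : G.ActionAssumption M) (hf : G.CostAssumption M) (hc : G.AggregateContinuity M)
    (A : Set (Act T)) (hAconv : Convex ℝ A) (hAcomp : IsCompact A)
    (hA : (A ∩ G.aggregates).Nonempty)
    (hmono : G.MonotoneOnProfiles (G.constrainedProfiles A)) :
    ∃ x : Profile T, G.IsVWE A x := by
  obtain ⟨B, hB⟩ : ∃ B, G.SubgradientBound M B := hf.subgradient_bound
  have hKc := convex_constrainedProfiles hX hAconv
  have hne : (G.constrainedProfiles A).Nonempty := by
    obtain ⟨_, hYA, x, hx, rfl⟩ := hA
    exact ⟨x, hx, hYA⟩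
  obtain ⟨x, hxK, hx⟩ := exists_minty_solution (R := M)
    (isClosed_constrainedProfiles hX hAcomp.isClosed) hKc
    (fun x hx => mem_closedBall_of_ae hM.le
      (Filter.Eventually.mono hx.1 fun θ hθ => hX.subset_ball θ hθ)) hne
    (P := {p | p.1 ∈ G.constrainedProfiles A ∧ p.2 ∈ G.H p.1}) (fun p hp => hp.1)
    (fun p hp q hq => by
      rw [inner_sub_eq_integral]
      refine (hmono _ hp.1 _ hq.1 _ hp.2 _ hq.2).trans_eq (integral_congr_ae ?_)
      filter_upwards [Lp.coeFn_sub p.2 q.2] with θ h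
      rw [h, Pi.sub_apply])
  have hminty : ∀ z ∈ G.constrainedProfiles A, ∀ h ∈ G.H z, 0 ≤ inner ℝ h (z - x) :=
    fun z hz h hh => hx (z, h) ⟨hz, hh⟩
  have hxb := hX.ae_mem_box hxK
  have hYb := aggregate_mem_box hxb
  obtain ⟨g, hg, hgv⟩ := exists_forall_inner_nonneg (S := G.H x) (R := B)
    (V := (fun y => y - x) '' G.constrainedProfiles A)
    (isClosed_setOf_ae_mem fun θ => isClosed_subdifferential)
    (convex_setOf_ae_mem fun θ => convex_subdifferential)
    (fun g hg => mem_closedBall_of_ae hB.1.le (by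
      filter_upwards [hg, hxb] with θ h1 h2
      exact mem_closedBall_zero_iff.2 (hB.2 θ _ h2 _ hYb _ h1)))
    (H_nonempty hM hf hB hxb)
    (by simpa [sub_eq_add_neg, add_comm] using hKc.translate (-x)) (by
      rintro _ ⟨y, hy, rfl⟩
      -- The segment from `x` to `y` stays feasible, so minimality at the frozen aggregate applies
      -- to each of its points.
      refine hf.exists_subgradient_inner_nonneg hM hB hYb hxb (hX.ae_mem_box hy) fun t ht => ?_
      refine (integral_cost_sub_nonneg_of_minty hM hX hf hc hB hAconv hxK
        (hKc hxK hy (sub_nonneg.2 ht.2.le) ht.1.le (by ring)) hminty).trans_eq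
        (integral_congr_ae ?_)
      filter_upwards [coeFn_combo x y (1 - t) t] with θ h
      rw [h])
  refine ⟨x, hxK, g, hg, fun y hy => ?_⟩
  rw [← inner_sub_eq_integral]
  exact hgv _ ⟨y, hy, rfl⟩
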